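/- Let $k$ be a field and let $H\subseteq\mathbb N$ be a numerical semigroup (a submonoid of $(\mathbb N,+)$ with finite complement) that is minimally generated by $a_1<a_2<\dots<a_n$, where $n\ge 2$ and $a_1=n$; that is, the number of minimal generators of $H$ equals its smallest nonzero element. Assume $H\neq\langle 2,3\rangle$. Let $R=k[[H]]$ be the ring of all power series in $k[[t]]$ whose exponents lie in $H$, let $K$ be its field of fractions and $\overline R$ the integral closure of $R$ in $K$. All colons are taken in $K$. For a ring $S$ with $R\subseteq S\subseteq K$ put $\mathfrak c(R,S)=\{r\in S: rS\subseteq R\}$, and $\mathfrak c(R)=\mathfrak c(R,\overline R)$. A canonical ideal of $R$ is a nonzero ideal $\omega$ of $R$ with $\omega:(\omega:J)=J$ for every nonzero fractional ideal $J$ of $R$ (equivalently, an ideal isomorphic to a canonical module of $R$). For an ideal $\omega$ let $R^{\omega}=\bigcup_{m\ge 0}(\omega^m:\omega^m)$ be its blowup algebra and $b(\omega)=\mathfrak c(R,R^{\omega})$. The ring $R$ has minimal canonical conductor if $b(\omega)=\mathfrak c(R)$ for a canonical ideal $\omega$ of $R$ (this does not depend on the choice of $\omega$). Then $R$ has minimal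 canonical conductor if and only if $a_n=a_{n-1}+1$. -/

import Mathlib

open scoped nonZeroDivisors PowerSeries

section Rings

variable (R : Type*) [CommRing R] (K : Type*) [Field K] [Algebra R K]

/-- The conductor `co(R, S) = {r ∈ S | r S ⊆ R}` of a birational extension `R ⊆ S ⊆ K`, where `K` is
the field of fractions of the domain `R`. -/
def birationalConductor (S : Subalgebra R K) : Submodule R K where
  carrier := {r | r ∈ S ∧ ∀ s ∈ S, r * s ∈ Set.range (algebraMap R K)}
  zero_mem' := ⟨S.zero_mem, fun s _ => ⟨0, by simp⟩⟩
  add_mem' := by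
    rintro x y ⟨hx, hx'⟩ ⟨hy, hy'⟩
    refine ⟨S.add_mem hx hy, fun s hs => ?_⟩
    obtain ⟨a, ha⟩ := hx' s hs
    obtain ⟨b, hb⟩ := hy' s hs
    exact ⟨a + b, by rw [map_add, ha, hb, add_mul]⟩
  smul_mem' := by
    rintro c x ⟨hx, hx'⟩
    refine ⟨S.smul_mem hx c, fun s hs => ?_⟩
    obtain ⟨a, ha⟩ := hx' s hs
    exact ⟨c * a, by rw [map_mul, ha, Algebra.smul_def, mul_assoc]⟩

/-- The conductor `co(R)`: the conductor of `R` in its normalisation, the integral closure of `R`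
in its field of fractions `K`. -/
def normalizationConductor : Submodule R K :=
  birationalConductor R K (integralClosure R K)

variable {R}

theorem colon_pow_le_colon_pow (J : Submodule R K) {m n : ℕ} (h : m ≤ n) :
    J ^ m / J ^ m ≤ J ^ n / J ^ n := by
  obtain ⟨d, rfl⟩ := Nat.exists_eq_add_of_le h
  rw [Submodule.le_div_iff_mul_le, pow_add, ← mul_assoc]
  exact mul_le_mul' (Submodule.le_div_iff_mul_le.mp le_rfl) le_rfl

/-- The blowup algebra `R^I = ⋃ₙ (Iⁿ : Iⁿ)` of an ideal `I` of `R`, the colons being taken in the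
field of fractions `K`. -/
def blowupAlgebra (I : Ideal R) : Subalgebra R K where
  carrier := {x | ∃ n : ℕ,
    x ∈ IsLocalization.coeSubmodule K I ^ n / IsLocalization.coeSubmodule K I ^ n}
  mul_mem' := by
    rintro x y ⟨m, hx⟩ ⟨n, hy⟩
    have hx' := colon_pow_le_colon_pow K _ (le_max_left m n) hx
    have hy' := colon_pow_le_colon_pow K _ (le_max_right m n) hy
    refine ⟨max m n, ?_⟩
    rw [Submodule.mem_div_iff_forall_mul_mem] at hx' hy' ⊢
    intro z hz
    rw [mul_assoc]
    exact hx' _ (hy' _ hz)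
  add_mem' := by
    rintro x y ⟨m, hx⟩ ⟨n, hy⟩
    exact ⟨max m n, Submodule.add_mem _ (colon_pow_le_colon_pow K _ (le_max_left m n) hx)
      (colon_pow_le_colon_pow K _ (le_max_right m n) hy)⟩
  algebraMap_mem' := by
    intro r
    refine ⟨0, ?_⟩
    rw [Submodule.mem_div_iff_forall_mul_mem]
    intro z hz
    rw [← Algebra.smul_def]
    exact Submodule.smul_mem _ _ hz

/-- `b(I) = co(R, R^I)`, the conductor of the blowup algebra of `I`. -/
def blowupConductor (I : Ideal R) : Submodule R K :=
  birationalConductor R K (blowupAlgebra K I)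

/-- A canonical ideal of a one-dimensional Noetherian local domain `R` with field of fractions `K`,
as defined by Herzog and Kunz: a nonzero ideal `ω` such that `ω : (ω : J) = J` for all nonzero
fractional ideals `J`, the colons being taken in `K`. Equivalently, `ω` is isomorphic to a canonical
module of `R`. -/
def IsCanonicalIdeal [IsDomain R] [IsFractionRing R K] (ω : Ideal R) : Prop :=
  ω ≠ ⊥ ∧ ∀ J : FractionalIdeal R⁰ K, J ≠ 0 →
    (ω : FractionalIdeal R⁰ K) / ((ω : FractionalIdeal R⁰ K) / J) = J

variable (R)

/-- Minimal canonical conductor, for a one-dimensional singular analytically unramified local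
domain `R`: the equality `b(ω) = co(R)` holds for a canonical ideal `ω` of `R`. (Canonical ideals
are unique up to multiplication by a nonzero element of the field of fractions, and `b(ω)` is
invariant under such a multiplication, so the choice of `ω` does not matter.) -/
def HasMinimalCanonicalConductor [IsDomain R] : Prop :=
  ∃ ω : Ideal R, IsCanonicalIdeal (FractionRing R) ω ∧
    blowupConductor (FractionRing R) ω = normalizationConductor R (FractionRing R)

end Rings

section Semigroups

/-- A numerical semigroup: a submonoid of `ℕ` with finite complement. -/
def IsNumericalSemigroup (H : AddSubmonoid ℕ) : Prop :=
  ((H : Set ℕ)ᶜ).Finite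

/-- `H` is minimally generated by `s`: `s` generates `H` and no proper subset of `s` does. -/
def IsMinimallyGeneratedBy (H : AddSubmonoid ℕ) (s : Set ℕ) : Prop :=
  AddSubmonoid.closure s = H ∧ ∀ s' : Set ℕ, s' ⊂ s → AddSubmonoid.closure s' ≠ H

/-- The numerical semigroup ring `k[[H]]`: the power series in `k[[t]]` all of whose exponents lie
in `H`. -/
def semigroupRing (k : Type*) [Field k] (H : AddSubmonoid ℕ) : Subalgebra k k⟦X⟧ where
  carrier := {f | ∀ i : ℕ, PowerSeries.coeff i f ≠ 0 → i ∈ H}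
  mul_mem' := by
    intro f g hf hg i hi
    rw [PowerSeries.coeff_mul] at hi
    obtain ⟨p, hp, hne⟩ := Finset.exists_ne_zero_of_sum_ne_zero hi
    rw [← Finset.HasAntidiagonal.mem_antidiagonal.mp hp]
    exact H.add_mem (hf _ (left_ne_zero_of_mul hne)) (hg _ (right_ne_zero_of_mul hne))
  add_mem' := by
    intro f g hf hg i hi
    by_cases h : PowerSeries.coeff i f = 0
    · exact hg i (fun h' => hi (by rw [map_add, h, h', add_zero]))
    · exact hf i h
  algebraMap_mem' := by
    intro c i hi
    by_cases h : i = 0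
    · exact h ▸ H.zero_mem
    · exact absurd (by simp [PowerSeries.coeff_C, h]) hi

end Semigroups

/-! Let `F = G + 1` be the largest gap of `H`. Both conditions are equivalent to `F - 1 = G` being a
gap. Combinatorics (`exists_frobenius_of_card_generators_eq`): by maximal embedding dimension the
Apéry set of `n` is 0 together with the generators other than `n`. Hence `F = a_n - n`, and `G` is a
gap iff `n + G = a_n - 1` is again such a generator, necessarily `a_{n-1}`. Only `⟨2,3⟩`, where
`a_{n-1}` is `n` itself, escapes. Algebra (`hasMinimalCanonicalConductor_iff`): if `G ∈ H`, then `ω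
: ω = R` and `t^F ∉ R` force every `g ∈ u⁻¹ω`, with `u ∈ ω` of least order, to have no linear term.
So `R^ω` lies in the ring `A` of series without linear term, and `t^G A ⊆ R` puts `t^G` in `b(ω)`
but not in the conductor, as `t^G * t ∉ R`. If `G` is a gap, the canonical ideal obtained as the
orthogonal complement of `R` under a residue-type pairing contains `t^(F+1)` and `t^(F+2)`. Their
ratio `t` lies in the blowup algebra, which is therefore `k[[t]]`. -/

/-! ### Minimal generators of submonoids of ℕ. -/

theorem minimallyGenerated_notMem_closure_diff {H : AddSubmonoid ℕ} {s : Set ℕ}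
    (h : IsMinimallyGeneratedBy H s) {x : ℕ} (hx : x ∈ s) :
    x ∉ AddSubmonoid.closure (s \ {x}) := by
  intro hx'
  refine h.2 (s \ {x}) (Set.sdiff_singleton_ssubset.mpr hx) (le_antisymm ?_ ?_)
  · exact h.1 ▸ AddSubmonoid.closure_mono Set.sdiff_subset
  · rw [← h.1, AddSubmonoid.closure_le]
    intro y hy
    by_cases hyx : y = x
    · exact hyx ▸ hx'
    · exact AddSubmonoid.subset_closure ⟨hy, hyx⟩

theorem mem_closure_inter_Iic {s : Set ℕ} {x : ℕ} (hx : x ∈ AddSubmonoid.closure s) :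
    x ∈ AddSubmonoid.closure (s ∩ Set.Iic x) := by
  induction hx using AddSubmonoid.closure_induction with
  | mem x hx => exact AddSubmonoid.subset_closure ⟨hx, Set.self_mem_Iic⟩
  | zero => exact zero_mem _
  | add x y _ _ hx hy =>
    refine add_mem (AddSubmonoid.closure_mono ?_ hx) (AddSubmonoid.closure_mono ?_ hy)
    · exact fun z hz => ⟨hz.1, hz.2.trans (Nat.le_add_right x y)⟩
    · exact fun z hz => ⟨hz.1, hz.2.trans (Nat.le_add_left y x)⟩

/-- A minimal generator does not decompose as the sum of another generator and an element. -/
theorem generator_ne_add {H : AddSubmonoid ℕ} {s : Set ℕ} (h : IsMinimallyGeneratedBy H s)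
    {x m y : ℕ} (hx : x ∈ s) (hm : m ∈ s) (hm0 : 0 < m) (hmx : m ≠ x) (hy : y ∈ H) :
    x ≠ m + y := by
  intro hxy
  refine minimallyGenerated_notMem_closure_diff h hx ?_
  have hy' : y ∈ AddSubmonoid.closure (s \ {x}) := by
    rw [← h.1] at hy
    refine AddSubmonoid.closure_mono ?_ (mem_closure_inter_Iic hy)
    -- The generators needed for `y` are at most `y`, and `y < x` because `m > 0`, so `x` is not
    -- among them.
    rintro z ⟨hz, hzy⟩
    refine ⟨hz, ?_⟩
    rintro rfl
    have : z ≤ y := hzy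
    omega
  have := add_mem (AddSubmonoid.subset_closure (show m ∈ s \ {x} from ⟨hm, hmx⟩)) hy'
  rwa [← hxy] at this

/-! ### Apéry set and Frobenius number in maximal embedding dimension. -/

section Apery

variable {H : AddSubmonoid ℕ} {n : ℕ} {a : Fin n → ℕ}

/-- In a numerical semigroup of maximal embedding dimension, zero and the generators other than the
multiplicity form the Apéry set of the multiplicity. -/
theorem exists_apery_of_card_generators_eq (hn : 1 < n) (ha : StrictMono a)
    (ha₁ : a ⟨0, by omega⟩ = n) (hgen : IsMinimallyGeneratedBy H (Set.range a)) (x : ℕ) :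
    ∃ w : ℕ, w ≡ x [MOD n] ∧ (∀ y, y ≡ w [MOD n] → (y ∈ H ↔ w ≤ y)) ∧
      (w = 0 ∨ ∃ i : Fin n, 0 < i.val ∧ a i = w) := by
  have hnpos : 0 < n := by omega
  have ha_mem : ∀ i, a i ∈ H := fun i => hgen.1 ▸ AddSubmonoid.subset_closure ⟨i, rfl⟩
  have hn_mem : n ∈ H := ha₁ ▸ ha_mem _
  have hmul : ∀ m, n * m ∈ H := fun m => by
    rw [mul_comm]; simpa using H.nsmul_mem hn_mem m
  have hlt : ∀ i : Fin n, 0 < i.val → n < a i := fun i hi => by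
    rw [← ha₁]; exact ha (show (⟨0, by omega⟩ : Fin n) < i from hi)
  have hgap : ∀ i : Fin n, 0 < i.val → ∀ y ∈ H, a i ≠ n + y := fun i hi y hy =>
    generator_ne_add hgen ⟨i, rfl⟩ ⟨⟨0, by omega⟩, ha₁⟩ hnpos (hlt i hi).ne hy
  -- The candidate Apéry set: the multiplicity `n`, which lies in the class of 0, is replaced by 0.
  let w : Fin n → ℕ := fun i => if i.val = 0 then 0 else a i
  have hw_mem : ∀ i, w i ∈ H := fun i => by
    simp only [w]; split_ifs; exacts [zero_mem _, ha_mem i]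
  have hw_gap : ∀ i, ∀ y ∈ H, w i ≠ n + y := fun i y hy => by
    simp only [w]; split_ifs with h; exacts [by omega, hgap i (by omega) y hy]
  -- A smaller element of `H` in the class of `w i` would give `w i = n + y'` with `y' ∈ H`, against
  -- minimality of the generators.
  have key : ∀ i y, y ≡ w i [MOD n] → y ∈ H → w i ≤ y := fun i y hy hyH => by
    by_contra! hlt'
    obtain ⟨c, hc⟩ := (Nat.modEq_iff_dvd' hlt'.le).mp hy
    obtain ⟨c, rfl⟩ : ∃ d, c = d + 1 := ⟨c - 1, by
      rcases c with _ | c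
      · simp only [Nat.mul_zero] at hc; omega
      · omega⟩
    refine hw_gap i (y + n * c) (add_mem hyH (hmul c)) ?_
    rw [mul_add] at hc
    omega
  -- Each `w i` is the least element of `H` in its class, so these `n` distinct numbers meet all `n`
  -- classes.
  have hinj : Function.Injective fun i : Fin n => (⟨w i % n, Nat.mod_lt _ hnpos⟩ : Fin n) := by
    intro i j hij
    have hij : w i ≡ w j [MOD n] := congrArg Fin.val hij
    have h1 := key i (w j) hij.symm (hw_mem j)
    have h2 := key j (w i) hij (hw_mem i)
    have h3 : w i = w j := le_antisymm h1 h2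
    simp only [w] at h3
    split_ifs at h3 with hi hj hj
    · exact Fin.ext (hi.trans hj.symm)
    · have := hlt j (by omega); omega
    · have := hlt i (by omega); omega
    · exact ha.injective h3
  obtain ⟨i, hi⟩ := Finite.surjective_of_injective hinj ⟨x % n, Nat.mod_lt _ hnpos⟩
  refine ⟨w i, congrArg Fin.val hi, fun y hy => ⟨key i y hy, fun hle => ?_⟩, ?_⟩
  · obtain ⟨c, hc⟩ := (Nat.modEq_iff_dvd' hle).mp hy.symm
    have : y = w i + n * c := by omega
    exact this ▸ add_mem (hw_mem i) (hmul c)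
  · by_cases h : i.val = 0
    · exact Or.inl (by simp [w, h])
    · exact Or.inr ⟨i, by omega, by simp [w, h]⟩

/-- The Frobenius number `G + 1` of a numerical semigroup of maximal embedding dimension, and when
its predecessor is a gap. -/
theorem exists_frobenius_of_card_generators_eq (hn : 1 < n) (ha : StrictMono a)
    (ha₁ : a ⟨0, by omega⟩ = n) (hgen : IsMinimallyGeneratedBy H (Set.range a))
    (hne : H ≠ AddSubmonoid.closure {2, 3}) :
    ∃ G : ℕ, G + 1 ∉ H ∧ (∀ x, G + 1 < x → x ∈ H) ∧
      (G ∉ H ↔ a ⟨n - 1, by omega⟩ = a ⟨n - 2, by omega⟩ + 1) := by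
  have hapery := exists_apery_of_card_generators_eq hn ha ha₁ hgen
  have ha_mem : ∀ i, a i ∈ H := fun i => hgen.1 ▸ AddSubmonoid.subset_closure ⟨i, rfl⟩
  have hlt : ∀ i : Fin n, 0 < i.val → n < a i := fun i hi => by
    rw [← ha₁]; exact ha (show (⟨0, by omega⟩ : Fin n) < i from hi)
  have hgap : ∀ i : Fin n, 0 < i.val → ∀ y, a i = n + y → y ∉ H := fun i hi y h hy =>
    generator_ne_add hgen ⟨i, rfl⟩ ⟨⟨0, by omega⟩, ha₁⟩ (by omega) (hlt i hi).ne hy h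
  have hle : ∀ i, a i ≤ a ⟨n - 1, by omega⟩ := fun i =>
    ha.monotone (show i.val ≤ n - 1 by omega)
  obtain ⟨G, hG⟩ : ∃ G, a ⟨n - 1, by omega⟩ = n + (G + 1) :=
    ⟨a ⟨n - 1, by omega⟩ - n - 1, by
      have := hlt ⟨n - 1, by omega⟩ (by simp only; omega)
      omega⟩
  have htop : ∀ x, G + 1 < x → x ∈ H := fun x hx => by
    obtain ⟨w, hwx, hw, h⟩ := hapery x
    refine (hw x hwx.symm).mpr ?_
    by_contra! hlt'
    have h1 : w ≤ n + (G + 1) := by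
      rcases h with rfl | ⟨i, -, rfl⟩
      · omega
      · exact hG ▸ hle i
    have h2 := (Nat.modEq_iff_dvd' hlt'.le).mp hwx.symm
    have := Nat.le_of_dvd (by omega) h2
    omega
  refine ⟨G, hgap _ (by simp only; omega) _ hG, htop, ?_, fun h => ?_⟩
  · intro hGH
    obtain ⟨w, hwx, hw, h⟩ := hapery (n + G)
    have hnG : n + G ≡ G [MOD n] := by simp [Nat.ModEq]
    have h1 : w ≤ n + G := (hw (n + G) hwx.symm).mp (htop _ (by omega))
    have h2 : ¬ w ≤ G := fun h => hGH ((hw G (hnG.symm.trans hwx.symm)).mpr h)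
    have h3 := (Nat.modEq_iff_dvd' h1).mp hwx
    -- As `G ∉ H` but `n + G ∈ H`, the Apéry element of this class is `n + G` itself, one less than
    -- the largest generator.
    have h4 : w = n + G := by
      by_contra h5
      have := Nat.le_of_dvd (by omega) h3
      omega
    obtain ⟨i, hi0, hi⟩ := h.resolve_left (by omega)
    have hi1 : i.val < n - 1 := by
      have : i < ⟨n - 1, by omega⟩ := ha.lt_iff_lt.mp (by omega)
      exact this
    have hi2 : a i ≤ a ⟨n - 2, by omega⟩ := ha.monotone (show i.val ≤ n - 2 by omega)
    have hi3 : a ⟨n - 2, by omega⟩ < a ⟨n - 1, by omega⟩ := ha (show n - 2 < n - 1 by omega)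
    omega
  -- For `n = 2` the index `n - 2` is that of the multiplicity, to which the gap argument does not
  -- apply; this is the case `⟨2,3⟩`.
  · by_cases hn2 : n = 2
    · subst hn2
      refine absurd ?_ hne
      rw [← hgen.1]
      congr 1
      have h0 : a 0 = 2 := ha₁
      have h1 : a 1 = a 0 + 1 := h
      ext x
      simp [Fin.exists_fin_two, h0, h1, eq_comm]
    · exact hgap ⟨n - 2, by omega⟩ (by simp only; omega) G (by omega)

end Apery

/-! ### Blowup algebras and canonical ideals over a general ring. -/

theorem mem_coeSubmodule_pow_of_forall_mul {R K : Type*} [CommRing R] [Field K] [Algebra R K]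
    {I : Ideal R} {u : R} (A : Subalgebra R K)
    (hA : ∀ f ∈ I, ∃ x ∈ A, algebraMap R K f = algebraMap R K u * x) (n : ℕ) {y : K}
    (hy : y ∈ IsLocalization.coeSubmodule K I ^ n) : ∃ x ∈ A, y = algebraMap R K u ^ n * x := by
  induction n generalizing y with
  | zero =>
    rw [pow_zero, Submodule.mem_one] at hy
    obtain ⟨r, rfl⟩ := hy
    exact ⟨_, A.algebraMap_mem r, by simp⟩
  | succ n ih =>
    rw [pow_succ] at hy
    induction hy using Submodule.mul_induction_on' with
    | mem_mul_mem p hp q hq =>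
      obtain ⟨x, hx, rfl⟩ := ih hp
      obtain ⟨f, hf, rfl⟩ := (IsLocalization.mem_coeSubmodule K I).mp hq
      obtain ⟨x', hx', h⟩ := hA f hf
      exact ⟨x * x', A.mul_mem hx hx', by rw [h]; ring⟩
    | add p _ q _ hp hq =>
      obtain ⟨x, hx, rfl⟩ := hp
      obtain ⟨x', hx', rfl⟩ := hq
      exact ⟨x + x', A.add_mem hx hx', by ring⟩

/-- If every element of `I` is a multiple of `u ∈ I` by an element of the overring `A`, then the
blowup algebra of `I` is contained in `A`. -/
theorem blowupAlgebra_le_of_forall_mul {R K : Type*} [CommRing R] [Field K] [Algebra R K]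
    {I : Ideal R} {u : R} (hu : u ∈ I) (hu0 : algebraMap R K u ≠ 0) (A : Subalgebra R K)
    (hA : ∀ f ∈ I, ∃ x ∈ A, algebraMap R K f = algebraMap R K u * x) :
    blowupAlgebra K I ≤ A := by
  rintro x ⟨n, hx⟩
  rw [Submodule.mem_div_iff_forall_mul_mem] at hx
  -- Testing `x` on `u ^ n ∈ I ^ n` gives `x * u ^ n ∈ u ^ n * A`, and `u ^ n` cancels.
  obtain ⟨y, hy, h⟩ := mem_coeSubmodule_pow_of_forall_mul A hA n
    (hx _ (Submodule.pow_mem_pow _ ((IsLocalization.mem_coeSubmodule K I).mpr ⟨u, hu, rfl⟩) n))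
  rw [mul_comm] at h
  exact mul_left_cancel₀ (pow_ne_zero n hu0) h ▸ hy

/-- A canonical ideal `ω` satisfies `ω : ω = R`. -/
theorem IsCanonicalIdeal.mem_range_of_forall_mul_mem {R K : Type*} [CommRing R] [IsDomain R]
    [Field K] [Algebra R K] [IsFractionRing R K] {ω : Ideal R} (h : IsCanonicalIdeal K ω) {x : K}
    (hx : ∀ f ∈ ω, ∃ g ∈ ω, x * algebraMap R K f = algebraMap R K g) :
    ∃ r, algebraMap R K r = x := by
  have hω : (ω : FractionalIdeal R⁰ K) ≠ 0 := by
    rw [Ne, FractionalIdeal.coeIdeal_eq_zero]; exact h.1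
  have h1 := h.2 1 one_ne_zero
  rw [FractionalIdeal.div_one] at h1
  rw [← FractionalIdeal.mem_one_iff R⁰, ← h1, FractionalIdeal.mem_div_iff_of_ne_zero hω]
  intro y hy
  obtain ⟨f, hf, rfl⟩ := (FractionalIdeal.mem_coeIdeal R⁰).mp hy
  obtain ⟨g, hg, h⟩ := hx f hf
  exact h ▸ FractionalIdeal.mem_coeIdeal_of_mem R⁰ hg

/-! ### Power series, Laurent series and the coefficient pairing. -/

namespace PowerSeries

variable {k : Type*} [Field k]

/-- To prove an additive property of power series, it suffices to treat monomials of degree below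
`N` and multiples of `X ^ N`. -/
theorem induction_C_mul_X_pow (N : ℕ) {P : k⟦X⟧ → Prop} (add : ∀ f g, P f → P g → P (f + g))
    (monomial : ∀ c : k, ∀ i < N, P (C c * X ^ i)) (shift : ∀ f, P (X ^ N * f)) (f : k⟦X⟧) :
    P f := by
  rw [eq_X_pow_mul_shift_add_trunc N f]
  refine add _ _ (shift _) ?_
  rw [trunc_apply, ← Polynomial.coeToPowerSeries.ringHom_apply, map_sum]
  refine Finset.sum_induction _ P add ?_ fun i hi => ?_
  · simpa using shift 0
  · rw [Polynomial.coeToPowerSeries.ringHom_apply, Polynomial.coe_monomial,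
      monomial_eq_C_mul_X_pow]
    exact monomial _ _ (by simpa using hi)

/-- Among the elements of a nonempty set of power series over a field, one divides all others. -/
theorem exists_mem_forall_dvd {s : Set k⟦X⟧} (hs : s.Nonempty) : ∃ u ∈ s, ∀ f ∈ s, u ∣ f := by
  obtain ⟨u, hu, h⟩ := (InvImage.wf (IsDiscreteValuationRing.addVal k⟦X⟧)
    wellFounded_lt).has_min s hs
  exact ⟨u, hu, fun f hf => IsDiscreteValuationRing.addVal_le_iff_dvd.mp (not_lt.mp (h f hf))⟩

end PowerSeries

namespace LaurentSeries

variable {k : Type*} [Field k]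

theorem exists_powerSeries_of_coeff_eq_zero {f : LaurentSeries k} {N : ℕ}
    (hf : ∀ i : ℤ, i < N → f.coeff i = 0) :
    ∃ p : k⟦X⟧, PowerSeries.X ^ N ∣ p ∧ algebraMap k⟦X⟧ (LaurentSeries k) p = f := by
  refine ⟨PowerSeries.mk fun n => f.coeff n, ?_, ?_⟩
  · rw [PowerSeries.X_pow_dvd_iff]
    intro m hm
    rw [PowerSeries.coeff_mk]
    exact hf _ (by exact_mod_cast hm)
  · ext i
    change (HahnSeries.ofPowerSeries ℤ k _).coeff i = _
    rw [PowerSeries.coeff_coe]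
    split_ifs with hi
    · exact (hf i (by omega)).symm
    · rw [PowerSeries.coeff_mk, Int.natAbs_of_nonneg (by omega)]

theorem coeff_mul_eq_zero {f g : LaurentSeries k} {a b D : ℤ} (hf : ∀ i < a, f.coeff i = 0)
    (hg : ∀ i < b, g.coeff i = 0) (hD : D < a + b) : (f * g).coeff D = 0 := by
  rw [HahnSeries.coeff_mul]
  refine Finset.sum_eq_zero fun p hp => ?_
  have hp := (Finset.mem_antidiagonal.mp hp).2.2
  by_cases h : p.1 < a
  · rw [hf _ h, zero_mul]
  · rw [hg p.2 (by omega), mul_zero]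

/-- A linear functional on Laurent series that vanishes in high degrees is of the form
`f ↦ coeff D (g * f)`. -/
theorem exists_coeff_mul_eq (D N : ℤ) (φ : LaurentSeries k →ₗ[k] k)
    (hφ : ∀ f : LaurentSeries k, (∀ i < N, f.coeff i = 0) → φ f = 0) :
    ∃ g : LaurentSeries k, ∀ f, (g * f).coeff D = φ f := by
  have hbdd : BddBelow (Function.support fun j : ℤ => φ (HahnSeries.single (D - j) 1)) := by
    refine ⟨D - N, fun j hj => ?_⟩
    by_contra! hlt
    refine hj (hφ _ fun i hi => HahnSeries.coeff_single_of_ne (by omega))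
  -- Testing on monomials forces these coefficients; the support is bounded below because `φ` kills
  -- high degrees.
  obtain ⟨g, hg⟩ : ∃ g : LaurentSeries k, g.coeff = fun j => φ (HahnSeries.single (D - j) 1) :=
    ⟨HahnSeries.ofSuppBddBelow _ hbdd, rfl⟩
  refine ⟨g, ?_⟩
  have hg0 : ∀ i < D - N + 1, g.coeff i = 0 := fun i hi => by
    rw [hg]
    exact hφ _ fun j hj => HahnSeries.coeff_single_of_ne (by omega)
  -- Both sides vanish on order at least `N`, so removing finitely many lowest terms suffices and no
  -- convergence is involved.
  have key : ∀ (m : ℕ) (f : LaurentSeries k), (∀ i < N - m, f.coeff i = 0) →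
      (g * f).coeff D = φ f := by
    intro m
    induction m with
    | zero =>
      intro f hf
      rw [hφ f (by simpa using hf)]
      exact coeff_mul_eq_zero hg0 hf (by simp only [Nat.cast_zero]; omega)
    | succ m ih =>
      intro f hf
      set b : ℤ := N - (m + 1 : ℕ) with hb
      set c := f.coeff b
      have h1 := ih (f - HahnSeries.single b c) (fun i hi => by
        rw [HahnSeries.coeff_sub]
        rcases eq_or_ne i b with rfl | hne
        · rw [HahnSeries.coeff_single_same]; exact sub_self _
        · rw [HahnSeries.coeff_single_of_ne hne, hf i (by push_cast at hb; omega), sub_zero])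
      have h2 : HahnSeries.single b c = c • HahnSeries.single b (1 : k) := by
        ext i
        by_cases hi : i = b <;> simp [hi]
      have h3 : (g * HahnSeries.single b c).coeff D = φ (HahnSeries.single b c) := by
        rw [mul_comm, HahnSeries.coeff_single_mul, hg, h2, map_smul, smul_eq_mul]
        simp
      rw [mul_sub, HahnSeries.coeff_sub, map_sub, h3] at h1
      exact sub_left_injective h1
  intro f
  by_cases hf : f = 0
  · simp [hf]
  refine key (N - f.order).toNat f fun i hi => HahnSeries.coeff_eq_zero_of_lt_order ?_
  omega

/-- Subspaces of Laurent series that contain all series of high order equal their double orthogonal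
complement for the pairing `coeff D (f * g)`. -/
theorem mem_of_forall_orthogonal (D N : ℤ) (J : Submodule k (LaurentSeries k))
    (hJ : ∀ f : LaurentSeries k, (∀ i < N, f.coeff i = 0) → f ∈ J) {x : LaurentSeries k}
    (hx : ∀ g : LaurentSeries k, (∀ y ∈ J, (g * y).coeff D = 0) → (g * x).coeff D = 0) :
    x ∈ J := by
  by_contra hxJ
  -- A functional separating `x` from `J` vanishes in high degrees, hence is given by the pairing
  -- with some `g` orthogonal to `J`.
  obtain ⟨φ, hφx, hφ⟩ := Submodule.exists_le_ker_of_notMem hxJ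
  obtain ⟨g, hg⟩ := exists_coeff_mul_eq D N φ fun f hf => hφ (hJ f hf)
  refine hφx ?_
  rw [← hg]
  exact hx g fun y hy => (hg y).trans (hφ hy)

end LaurentSeries

/-! ### The ring `k[[H]]`, its field of fractions and its normalisation. -/

namespace semigroupRing

open PowerSeries

variable {k : Type*} [Field k] {H : AddSubmonoid ℕ} {F : ℕ}

theorem C_mem (c : k) : C c ∈ semigroupRing k H := (semigroupRing k H).algebraMap_mem c

theorem X_pow_mem_iff {i : ℕ} : (X ^ i : k⟦X⟧) ∈ semigroupRing k H ↔ i ∈ H := by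
  refine ⟨fun h => h i (by simp), fun h j hj => ?_⟩
  rw [coeff_X_pow] at hj
  exact (by simpa using hj : j = i) ▸ h

theorem mem_of_X_pow_dvd (hF : ∀ x, F < x → x ∈ H) {f : k⟦X⟧} (h : X ^ (F + 1) ∣ f) :
    f ∈ semigroupRing k H := fun i hi => by
  by_contra hiH
  refine hi (X_pow_dvd_iff.mp h i ?_)
  by_contra hlt
  exact hiH (hF i (by omega))

theorem algebraMap_laurentSeries (r : semigroupRing k H) :
    algebraMap (semigroupRing k H) (LaurentSeries k) r = algebraMap k⟦X⟧ (LaurentSeries k) r :=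
  rfl

theorem isFractionRing_laurentSeries (hF : ∀ x, F < x → x ∈ H) :
    IsFractionRing (semigroupRing k H) (LaurentSeries k) := by
  have : FaithfulSMul (semigroupRing k H) (LaurentSeries k) := by
    rw [faithfulSMul_iff_algebraMap_injective]
    exact (IsFractionRing.injective k⟦X⟧ (LaurentSeries k)).comp Subtype.val_injective
  refine IsFractionRing.of_field _ _ fun z => ?_
  obtain ⟨a, b, hb, rfl⟩ := IsFractionRing.div_surjective (A := k⟦X⟧) z
  -- Expanding the fraction by `X ^ (F + 1)` moves numerator and denominator into `k[[H]]`.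
  refine ⟨⟨X ^ (F + 1) * a, mem_of_X_pow_dvd hF (dvd_mul_right _ _)⟩,
    ⟨X ^ (F + 1) * b, mem_of_X_pow_dvd hF (dvd_mul_right _ _)⟩, ?_⟩
  rw [algebraMap_laurentSeries, algebraMap_laurentSeries, map_mul, map_mul, mul_div_mul_left]
  rw [Ne, FaithfulSMul.algebraMap_eq_zero_iff]
  exact pow_ne_zero _ X_ne_zero

section Embedding

variable (k H)
variable [IsFractionRing (semigroupRing k H) (LaurentSeries k)]

/-- The embedding of `k[[t]]` into the field of fractions of `k[[H]]`. -/
noncomputable def powerSeriesEmbedding :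
    k⟦X⟧ →ₐ[semigroupRing k H] FractionRing (semigroupRing k H) :=
  (FractionRing.algEquiv (semigroupRing k H) (LaurentSeries k)).symm.toAlgHom.comp
    (IsScalarTower.toAlgHom (semigroupRing k H) k⟦X⟧ (LaurentSeries k))

variable {k H}

theorem algEquiv_powerSeriesEmbedding (f : k⟦X⟧) :
    FractionRing.algEquiv (semigroupRing k H) (LaurentSeries k) (powerSeriesEmbedding k H f) =
      algebraMap k⟦X⟧ (LaurentSeries k) f :=
  (FractionRing.algEquiv (semigroupRing k H) (LaurentSeries k)).apply_symm_apply _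

theorem powerSeriesEmbedding_injective : Function.Injective (powerSeriesEmbedding k H) :=
  fun f g h => IsFractionRing.injective k⟦X⟧ (LaurentSeries k) (by
    rw [← algEquiv_powerSeriesEmbedding (H := H), h, algEquiv_powerSeriesEmbedding])

theorem powerSeriesEmbedding_coe (r : semigroupRing k H) :
    powerSeriesEmbedding k H r = algebraMap _ (FractionRing (semigroupRing k H)) r :=
  (powerSeriesEmbedding k H).commutes r

theorem powerSeriesEmbedding_mem_range_iff {f : k⟦X⟧} :
    powerSeriesEmbedding k H f ∈
      Set.range (algebraMap (semigroupRing k H) (FractionRing (semigroupRing k H))) ↔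
    f ∈ semigroupRing k H := by
  refine ⟨?_, fun hf => ⟨⟨f, hf⟩, (powerSeriesEmbedding_coe ⟨f, hf⟩).symm⟩⟩
  rintro ⟨r, hr⟩
  rw [← powerSeriesEmbedding_coe] at hr
  exact powerSeriesEmbedding_injective hr ▸ r.2

/-- The normalisation of `k[[H]]` is `k[[t]]`. -/
theorem integralClosure_eq_range (hF : ∀ x, F < x → x ∈ H) :
    integralClosure (semigroupRing k H) (FractionRing (semigroupRing k H)) =
      (powerSeriesEmbedding k H).range := by
  refine le_antisymm (fun x hx => ?_) ?_
  · have h1 : IsIntegral (semigroupRing k H)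
        (FractionRing.algEquiv (semigroupRing k H) (LaurentSeries k) x) := IsIntegral.map _ hx
    have h2 : IsIntegral k⟦X⟧ (FractionRing.algEquiv (semigroupRing k H) (LaurentSeries k) x) :=
      h1.tower_top
    obtain ⟨f, hf⟩ := IsIntegrallyClosed.isIntegral_iff.mp h2
    refine ⟨f, (FractionRing.algEquiv (semigroupRing k H) (LaurentSeries k)).injective ?_⟩
    exact (algEquiv_powerSeriesEmbedding f).trans hf
  · rintro _ ⟨f, rfl⟩
    refine IsIntegral.map (powerSeriesEmbedding k H) ?_
    have hmem : ∀ g ∈ semigroupRing k H, IsIntegral (semigroupRing k H) g := fun g hg =>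
      isIntegral_algebraMap (x := (⟨g, hg⟩ : semigroupRing k H))
    refine induction_C_mul_X_pow (F + 1) (fun _ _ => IsIntegral.add) (fun c i _ => ?_)
      (fun g => hmem _ (mem_of_X_pow_dvd hF (dvd_mul_right _ _))) f
    -- The power `(X ^ i) ^ (F + 1)` lies in `k[[H]]`: its exponent is 0 or exceeds `F`.
    refine IsIntegral.mul (hmem _ (C_mem c)) (IsIntegral.of_pow F.succ_pos (hmem _ ?_))
    rw [← pow_mul, X_pow_mem_iff]
    rcases Nat.eq_zero_or_pos i with rfl | hi
    · rw [zero_mul]; exact H.zero_mem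
    · exact hF _ (lt_of_lt_of_le F.lt_succ_self (Nat.le_mul_of_pos_left _ hi))

end Embedding

/-! ### Minimal canonical conductor forces `G` to be a gap. -/

variable {G : ℕ}

/-- An ideal of `k[[H]]` that is not stable under multiplication by `t` to the Frobenius number
has, relative to an element of least order, no element of relative order one, provided that the
predecessor of the Frobenius number lies in `H`. -/
theorem coeff_one_eq_zero_of_mul_mem (hF : ∀ x, G + 1 < x → x ∈ H) (hG : G ∈ H)
    {ω : Ideal (semigroupRing k H)} {u : semigroupRing k H} (hu : u ∈ ω)
    (hdvd : ∀ f ∈ ω, (u : k⟦X⟧) ∣ f)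
    (hω : ¬ ∀ f ∈ ω, ∃ g ∈ ω, (X ^ (G + 1) : k⟦X⟧) * (f : k⟦X⟧) = (g : k⟦X⟧))
    {r : semigroupRing k H} (hr : r ∈ ω) {g : k⟦X⟧} (hg : (r : k⟦X⟧) = u * g) :
    coeff 1 g = 0 := by
  by_contra hg1
  refine hω ?_
  let W : Submodule (semigroupRing k H) k⟦X⟧ :=
    Submodule.map (Algebra.linearMap (semigroupRing k H) k⟦X⟧) ω
  have memW : ∀ {f : semigroupRing k H}, f ∈ ω → (f : k⟦X⟧) ∈ W := fun hf => ⟨_, hf, rfl⟩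
  have smulW : ∀ {s v : k⟦X⟧}, s ∈ semigroupRing k H → v ∈ W → s * v ∈ W := fun {s v} hs hv =>
    W.smul_mem ⟨s, hs⟩ hv
  have high : ∀ w : k⟦X⟧, X ^ (G + 2) ∣ w → w * u ∈ W := fun w hw =>
    smulW (mem_of_X_pow_dvd hF hw) (memW hu)
  have hXG : (X ^ G : k⟦X⟧) ∈ semigroupRing k H := X_pow_mem_iff.mpr hG
  have dvd1 : X ^ (G + 2) ∣
      X ^ G * g - C (coeff 0 g) * X ^ G - C (coeff 1 g) * X ^ (G + 1) := by
    have : X ^ 2 ∣ g - C (coeff 0 g) - C (coeff 1 g) * X := by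
      rw [X_pow_dvd_iff]
      intro m hm
      interval_cases m <;> simp
    rw [pow_add]
    convert mul_dvd_mul_left (X ^ G) this using 1
    ring
  -- Multiplying `r = u * g` by `X ^ G ∈ k[[H]]` and removing the constant term and the tail of `g`
  -- isolates `X ^ (G + 1) * u`, up to the unit `coeff 1 g`.
  have step : X ^ (G + 1) * (u : k⟦X⟧) ∈ W := by
    have h1 : C (coeff 1 g) * (X ^ (G + 1) * (u : k⟦X⟧)) ∈ W := by
      have h2 := W.sub_mem (W.sub_mem (smulW hXG (memW hr))
        (smulW (mul_mem (C_mem (coeff 0 g)) hXG) (memW hu))) (high _ dvd1)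
      convert h2 using 1
      rw [hg]
      ring
    have h3 := smulW (C_mem (H := H) (coeff 1 g)⁻¹) h1
    rwa [← mul_assoc, ← map_mul, inv_mul_cancel₀ hg1, map_one, one_mul] at h3
  intro f hf
  obtain ⟨h, hh⟩ := hdvd f hf
  have dvd2 : X ^ (G + 2) ∣ X ^ (G + 1) * (h - C (coeff 0 h)) := by
    rw [pow_succ X (G + 1)]
    exact mul_dvd_mul_left _ (X_dvd_iff.mpr (by simp))
  obtain ⟨r', hr', h'⟩ := W.add_mem (smulW (C_mem (coeff 0 h)) step) (high _ dvd2)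
  refine ⟨r', hr', ?_⟩
  refine Eq.trans ?_ h'.symm
  rw [hh]
  ring

/-- If `k[[H]]` has minimal canonical conductor, then the predecessor of the Frobenius number of `H`
is a gap. -/
theorem notMem_of_hasMinimalCanonicalConductor (hG1 : G + 1 ∉ H) (hF : ∀ x, G + 1 < x → x ∈ H)
    (h : HasMinimalCanonicalConductor (semigroupRing k H)) : G ∉ H := by
  intro hG
  obtain ⟨ω, hω, hb⟩ := h
  have := isFractionRing_laurentSeries (k := k) hF
  have hone : 1 ∉ H := fun h1 => hG1 (by simpa using H.nsmul_mem h1 (G + 1))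
  obtain ⟨u, ⟨⟨hu, hu0⟩, hmin⟩⟩ : ∃ u, (u ∈ ω ∧ u ≠ 0) ∧ ∀ f ∈ ω, (u : k⟦X⟧) ∣ f := by
    obtain ⟨v, hv, hv0⟩ := (Submodule.ne_bot_iff ω).mp hω.1
    obtain ⟨_, ⟨u, hu, rfl⟩, hmin⟩ := exists_mem_forall_dvd
      (s := (fun f : semigroupRing k H => (f : k⟦X⟧)) '' {f | f ∈ ω}) ⟨_, v, hv, rfl⟩
    refine ⟨u, ⟨hu, ?_⟩, fun f hf => hmin _ ⟨f, hf, rfl⟩⟩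
    rintro rfl
    exact hv0 (Subtype.ext (zero_dvd_iff.mp (hmin _ ⟨v, hv, rfl⟩)))
  -- Stability would put `X ^ (G + 1)` in `ω : ω = R`, although `G + 1` is a gap.
  have hstable : ¬ ∀ f ∈ ω, ∃ g ∈ ω, (X ^ (G + 1) : k⟦X⟧) * (f : k⟦X⟧) = (g : k⟦X⟧) := by
    intro hcon
    obtain ⟨r, hr⟩ := hω.mem_range_of_forall_mul_mem (x := powerSeriesEmbedding k H (X ^ (G + 1)))
      (fun f hf => by
        obtain ⟨g, hg, h⟩ := hcon f hf
        refine ⟨g, hg, ?_⟩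
        rw [← powerSeriesEmbedding_coe, ← powerSeriesEmbedding_coe, ← map_mul, h])
    exact hG1 (X_pow_mem_iff.mp (powerSeriesEmbedding_mem_range_iff.mp ⟨r, hr⟩))
  -- Series without linear term form a ring, which contains `k[[H]]` because `1 ∉ H`.
  let A : Subalgebra (semigroupRing k H) k⟦X⟧ :=
    { carrier := {f | coeff 1 f = 0}
      mul_mem' := by
        intro f g hf hg
        have h1 : coeff 1 f = 0 := hf
        have h2 : coeff 1 g = 0 := hg
        change coeff 1 (f * g) = 0
        rw [coeff_mul, Finset.Nat.antidiagonal_succ]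
        simp [h1, h2]
      add_mem' := by
        intro f g hf hg
        change coeff 1 (f + g) = 0
        rw [map_add, show coeff 1 f = 0 from hf, show coeff 1 g = 0 from hg, add_zero]
      algebraMap_mem' := fun r => by
        by_contra hr
        exact hone (r.2 1 hr) }
  have hle : blowupAlgebra (FractionRing (semigroupRing k H)) ω ≤
      A.map (powerSeriesEmbedding k H) := by
    refine blowupAlgebra_le_of_forall_mul hu ?_ _ fun f hf => ?_
    · rwa [Ne, FaithfulSMul.algebraMap_eq_zero_iff]
    · obtain ⟨g, hg⟩ := hmin f hf
      refine ⟨_, ⟨g, coeff_one_eq_zero_of_mul_mem hF hG hu hmin hstable hf hg, rfl⟩, ?_⟩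
      change _ = _ * powerSeriesEmbedding k H g
      rw [← powerSeriesEmbedding_coe, ← powerSeriesEmbedding_coe, hg, map_mul]
  have hXG : (X ^ G : k⟦X⟧) ∈ semigroupRing k H := X_pow_mem_iff.mpr hG
  have hmem : powerSeriesEmbedding k H (X ^ G) ∈
      blowupConductor (FractionRing (semigroupRing k H)) ω := by
    refine ⟨?_, fun s hs => ?_⟩
    · rw [powerSeriesEmbedding_coe ⟨_, hXG⟩]
      exact Subalgebra.algebraMap_mem _ _
    · obtain ⟨f, hf, rfl⟩ := hle hs
      have hf : coeff 1 f = 0 := hf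
      change powerSeriesEmbedding k H (X ^ G) * powerSeriesEmbedding k H f ∈ _
      rw [← map_mul, powerSeriesEmbedding_mem_range_iff]
      -- Since `f` has no linear term, the second summand has order at least `G + 2` and skips the
      -- gap `G + 1`.
      have h1 : X ^ G * f = X ^ G * C (coeff 0 f) + X ^ G * (f - C (coeff 0 f)) := by ring
      rw [h1]
      refine add_mem (mul_mem hXG (C_mem _)) (mem_of_X_pow_dvd hF ?_)
      rw [pow_add X G 2]
      refine mul_dvd_mul_left _ (X_pow_dvd_iff.mpr fun m hm => ?_)
      interval_cases m <;> simp [hf]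
  rw [hb] at hmem
  have := hmem.2 (powerSeriesEmbedding k H X) (by
    rw [integralClosure_eq_range hF]; exact ⟨X, rfl⟩)
  rw [← map_mul, powerSeriesEmbedding_mem_range_iff, ← pow_succ, X_pow_mem_iff] at this
  exact hG1 this

/-! ### An explicit canonical ideal and its duality. -/

variable (k H F) in
/-- For `F` the Frobenius number of `H`, a canonical ideal of `k[[H]]`: the power series `r`
such that all products of `r` with elements of `k[[H]]` have vanishing coefficient in degree
`2F + 1`. -/
noncomputable def canonicalIdeal : Ideal (semigroupRing k H) where
  carrier := {r | ∀ s : semigroupRing k H, coeff (2 * F + 1) (r * s : k⟦X⟧) = 0}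
  zero_mem' := fun s => by simp
  add_mem' := fun {a b} ha hb s => by
    rw [Subalgebra.coe_add, add_mul, map_add, ha s, hb s, add_zero]
  smul_mem' := fun c a ha s => by
    have := ha (c * s)
    rw [Subalgebra.coe_mul] at this
    rw [smul_eq_mul, Subalgebra.coe_mul, mul_comm (c : k⟦X⟧), mul_assoc, this]

/-- For `i ≤ F` the exponent `2F + 1 - i` exceeds `F`, so pairing with that monomial reads off the
`i`-th coefficient. This explains the degree `2F + 1`: the orthogonal complement of `k[[H]]` then
lies in `X ^ (F + 1) k[[X]]`, inside `k[[H]]`. -/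
theorem X_pow_dvd_of_mem_canonicalIdeal (hF : ∀ x, F < x → x ∈ H) {r : semigroupRing k H}
    (hr : r ∈ canonicalIdeal k H F) : X ^ (F + 1) ∣ (r : k⟦X⟧) := by
  rw [X_pow_dvd_iff]
  intro i hi
  have := hr ⟨X ^ (2 * F + 1 - i), X_pow_mem_iff.mpr (hF _ (by omega))⟩
  rwa [coeff_mul_X_pow', if_pos (by omega), show 2 * F + 1 - (2 * F + 1 - i) = i by omega] at this

/-- Pairing this monomial with `s` gives the coefficient of `s` at the gap `F - i`. The cases `i =
0, 1` supply the two elements with ratio `X`. -/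
theorem exists_X_pow_mem_canonicalIdeal (hF : ∀ x, F < x → x ∈ H) {i : ℕ} (hi : i ≤ F)
    (hiH : F - i ∉ H) : ∃ r ∈ canonicalIdeal k H F, (r : k⟦X⟧) = X ^ (F + 1 + i) := by
  refine ⟨⟨X ^ (F + 1 + i), X_pow_mem_iff.mpr (hF _ (by omega))⟩, fun s => ?_, rfl⟩
  rw [coeff_X_pow_mul', if_pos (by omega), show 2 * F + 1 - (F + 1 + i) = F - i by omega]
  by_contra h
  exact hiH (s.2 _ h)

theorem exists_X_pow_mul_mem_canonicalIdeal (hF : ∀ x, F < x → x ∈ H) (f : k⟦X⟧) :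
    ∃ r ∈ canonicalIdeal k H F, (r : k⟦X⟧) = X ^ (F + 1) * (X ^ (F + 1) * f) := by
  refine ⟨⟨X ^ (F + 1) * (X ^ (F + 1) * f), mem_of_X_pow_dvd hF (dvd_mul_right _ _)⟩,
    fun s => ?_, rfl⟩
  change coeff (2 * F + 1) (X ^ (F + 1) * (X ^ (F + 1) * f) * (s : k⟦X⟧)) = 0
  rw [← mul_assoc, ← pow_add, mul_assoc, coeff_X_pow_mul', if_neg (by omega)]

/-- Orthogonality to `X ^ (2F + 1 - i)` for all integers `i ≤ F`, negative ones included, already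
makes `z` a power series of order above `F`. The orthogonal complement taken in the whole field is
thus no larger. -/
theorem exists_mem_canonicalIdeal_of_laurentSeries (hF : ∀ x, F < x → x ∈ H) {z : LaurentSeries k}
    (hz : ∀ s : semigroupRing k H,
      (z * algebraMap k⟦X⟧ (LaurentSeries k) s).coeff (2 * F + 1) = 0) :
    ∃ r ∈ canonicalIdeal k H F, algebraMap k⟦X⟧ (LaurentSeries k) r = z := by
  obtain ⟨p, hp, rfl⟩ := LaurentSeries.exists_powerSeries_of_coeff_eq_zero (f := z) (N := F + 1)
    (fun i hi => by
      have h1 := hz ⟨X ^ (2 * F + 1 - i).toNat, X_pow_mem_iff.mpr (hF _ (by omega))⟩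
      have h2 : algebraMap k⟦X⟧ (LaurentSeries k) (X ^ (2 * F + 1 - i).toNat) =
        HahnSeries.single ((2 * F + 1 - i).toNat : ℤ) 1 := HahnSeries.ofPowerSeries_X_pow _
      rw [h2, mul_comm, HahnSeries.coeff_single_mul, one_mul] at h1
      rwa [show (2 * F + 1 : ℤ) - ((2 * F + 1 - i).toNat : ℤ) = i by omega] at h1)
  refine ⟨⟨p, mem_of_X_pow_dvd hF hp⟩, fun s => ?_, rfl⟩
  rw [← LaurentSeries.coeff_coe_powerSeries, map_mul]
  exact_mod_cast hz s

theorem canonicalIdeal_ne_bot (hF : ∀ x, F < x → x ∈ H) : canonicalIdeal k H F ≠ ⊥ := by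
  obtain ⟨r, hr, h⟩ := exists_X_pow_mul_mem_canonicalIdeal (k := k) hF 1
  refine (Submodule.ne_bot_iff _).mpr ⟨r, hr, ?_⟩
  rintro rfl
  rw [mul_one, ← pow_add] at h
  exact pow_ne_zero _ X_ne_zero h.symm

theorem algebraMap_mul_mem {J : FractionalIdeal (semigroupRing k H)⁰
    (FractionRing (semigroupRing k H))} (r : semigroupRing k H)
    {y : FractionRing (semigroupRing k H)} (hy : y ∈ J) : algebraMap _ _ r * y ∈ J := by
  rw [← Algebra.smul_def]
  exact J.coeToSubmodule.smul_mem r hy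

section Duality

variable [IsFractionRing (semigroupRing k H) (LaurentSeries k)]

theorem algEquiv_algebraMap (r : semigroupRing k H) :
    FractionRing.algEquiv (semigroupRing k H) (LaurentSeries k) (algebraMap _ _ r) =
      algebraMap k⟦X⟧ (LaurentSeries k) r :=
  (FractionRing.algEquiv (semigroupRing k H) (LaurentSeries k)).commutes r

/-- A fractional ideal of `k[[H]]`, as a subspace of the field of Laurent series. -/
noncomputable def laurentSubmodule (J : FractionalIdeal (semigroupRing k H)⁰
    (FractionRing (semigroupRing k H))) : Submodule k (LaurentSeries k) where
  carrier := {z | (FractionRing.algEquiv (semigroupRing k H) (LaurentSeries k)).symm z ∈ J}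
  zero_mem' := by
    rw [Set.mem_ofPred_eq, map_zero]
    exact J.coeToSubmodule.zero_mem
  add_mem' := fun {a b} ha hb => by
    rw [Set.mem_ofPred_eq, map_add]
    exact J.coeToSubmodule.add_mem ha hb
  smul_mem' := fun c z hz => by
    have h1 : c • z = algebraMap k⟦X⟧ (LaurentSeries k) (C c) * z :=
      (HahnSeries.C_mul_eq_smul).symm.trans
        (congrArg (· * z) (HahnSeries.ofPowerSeries_C c).symm)
    rw [Set.mem_ofPred_eq, h1, ← algEquiv_algebraMap (H := H) ⟨C c, C_mem c⟩, map_mul,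
      AlgEquiv.symm_apply_apply]
    exact algebraMap_mul_mem _ hz

theorem mem_laurentSubmodule {J : FractionalIdeal (semigroupRing k H)⁰
    (FractionRing (semigroupRing k H))} {z : LaurentSeries k} :
    z ∈ laurentSubmodule J ↔
      (FractionRing.algEquiv (semigroupRing k H) (LaurentSeries k)).symm z ∈ J := Iff.rfl

theorem algEquiv_mem_laurentSubmodule {J : FractionalIdeal (semigroupRing k H)⁰
    (FractionRing (semigroupRing k H))} {x : FractionRing (semigroupRing k H)} :
    FractionRing.algEquiv (semigroupRing k H) (LaurentSeries k) x ∈ laurentSubmodule J ↔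
      x ∈ J := by
  rw [mem_laurentSubmodule, AlgEquiv.symm_apply_apply]

/-- A nonzero fractional ideal of `k[[H]]` contains all Laurent series of high order. -/
theorem exists_forall_mem_laurentSubmodule (hF : ∀ x, F < x → x ∈ H)
    {J : FractionalIdeal (semigroupRing k H)⁰ (FractionRing (semigroupRing k H))} (hJ : J ≠ 0) :
    ∃ N : ℤ, ∀ f : LaurentSeries k, (∀ i < N, f.coeff i = 0) → f ∈ laurentSubmodule J := by
  obtain ⟨b, hb0, hb⟩ := FractionalIdeal.exists_ne_zero_mem_isInteger hJ
  have hb0' : (b : k⟦X⟧) ≠ 0 := fun h => hb0 (Subtype.ext h)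
  -- Up to a unit `b` is a power of `X`, so every series of order at least `ord b + F + 1` is `b`
  -- times one in `X ^ (F + 1) k[[X]] ⊆ k[[H]]`.
  obtain ⟨v, hv⟩ : ∃ v : k⟦X⟧, (b : k⟦X⟧) * v = X ^ (b : k⟦X⟧).order.toNat := by
    have h1 := Unit_of_divided_by_X_pow_order_nonzero hb0'
    refine ⟨((Unit_of_divided_by_X_pow_order (b : k⟦X⟧))⁻¹ : k⟦X⟧ˣ), ?_⟩
    rw [Units.mul_inv_eq_iff_eq_mul, h1, X_pow_order_mul_divXPowOrder]
  refine ⟨((b : k⟦X⟧).order.toNat + (F + 1) : ℕ), fun f hf => ?_⟩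
  obtain ⟨_, ⟨p, rfl⟩, rfl⟩ := LaurentSeries.exists_powerSeries_of_coeff_eq_zero hf
  have h1 : X ^ ((b : k⟦X⟧).order.toNat + (F + 1)) * p =
      ((⟨X ^ (F + 1) * (v * p), mem_of_X_pow_dvd hF (dvd_mul_right _ _)⟩ :
        semigroupRing k H) : k⟦X⟧) * (b : k⟦X⟧) := by
    rw [pow_add, ← hv]
    ring
  rw [h1, map_mul, ← algEquiv_algebraMap, ← algEquiv_algebraMap, ← map_mul,
    algEquiv_mem_laurentSubmodule]
  exact algebraMap_mul_mem _ hb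

theorem mem_canonicalIdeal_iff_coeff (hF : ∀ x, F < x → x ∈ H)
    {z : FractionRing (semigroupRing k H)} :
    z ∈ (↑(canonicalIdeal k H F) :
      FractionalIdeal (semigroupRing k H)⁰ (FractionRing (semigroupRing k H))) ↔
    ∀ s : semigroupRing k H, (FractionRing.algEquiv (semigroupRing k H) (LaurentSeries k) z *
      algebraMap k⟦X⟧ (LaurentSeries k) s).coeff (2 * F + 1) = 0 := by
  rw [FractionalIdeal.mem_coeIdeal]
  constructor
  · rintro ⟨r, hr, rfl⟩ s
    have h1 := hr s
    rw [← LaurentSeries.coeff_coe_powerSeries, map_mul] at h1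
    rw [algEquiv_algebraMap]
    exact_mod_cast h1
  · intro hz
    obtain ⟨r, hr, h⟩ := exists_mem_canonicalIdeal_of_laurentSeries hF hz
    refine ⟨r, hr, (FractionRing.algEquiv (semigroupRing k H) (LaurentSeries k)).injective ?_⟩
    rw [algEquiv_algebraMap, h]

/-- The colon of the canonical ideal by `J` is the orthogonal complement of `J`. -/
theorem mem_canonicalIdeal_div_iff (hF : ∀ x, F < x → x ∈ H)
    {J : FractionalIdeal (semigroupRing k H)⁰ (FractionRing (semigroupRing k H))} (hJ : J ≠ 0)
    {z : FractionRing (semigroupRing k H)} :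
    z ∈ (↑(canonicalIdeal k H F) :
      FractionalIdeal (semigroupRing k H)⁰ (FractionRing (semigroupRing k H))) / J ↔
    ∀ y ∈ J, (FractionRing.algEquiv (semigroupRing k H) (LaurentSeries k) z *
      FractionRing.algEquiv (semigroupRing k H) (LaurentSeries k) y).coeff (2 * F + 1) = 0 := by
  rw [FractionalIdeal.mem_div_iff_of_ne_zero hJ]
  refine ⟨fun h y hy => ?_, fun h y hy => ?_⟩
  · have h1 := (mem_canonicalIdeal_iff_coeff hF).mp (h y hy) 1
    rwa [OneMemClass.coe_one, map_one, mul_one, map_mul] at h1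
  · rw [mem_canonicalIdeal_iff_coeff hF]
    intro s
    -- The test element `s` is absorbed into `y`, since `J` is a `k[[H]]`-module.
    rw [map_mul, mul_assoc, mul_comm _ (algebraMap k⟦X⟧ _ _), ← algEquiv_algebraMap, ← map_mul]
    exact h _ (algebraMap_mul_mem s hy)

end Duality

/-- A nonzero element of the ideal times a common denominator of `J` lies in the colon. Nonvanishing
is needed because the quotient by the zero fractional ideal is not the colon. -/
theorem canonicalIdeal_div_ne_zero (hF : ∀ x, F < x → x ∈ H)
    {J : FractionalIdeal (semigroupRing k H)⁰ (FractionRing (semigroupRing k H))} (hJ : J ≠ 0) :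
    (↑(canonicalIdeal k H F) :
      FractionalIdeal (semigroupRing k H)⁰ (FractionRing (semigroupRing k H))) / J ≠ 0 := by
  obtain ⟨b, hb, hbJ⟩ := J.isFractional
  obtain ⟨r, hr, hr0⟩ := (Submodule.ne_bot_iff _).mp (canonicalIdeal_ne_bot (k := k) hF)
  intro h0
  have hmem : algebraMap (semigroupRing k H) (FractionRing (semigroupRing k H)) (r * b) ∈
      (↑(canonicalIdeal k H F) :
        FractionalIdeal (semigroupRing k H)⁰ (FractionRing (semigroupRing k H))) / J := by
    rw [FractionalIdeal.mem_div_iff_of_ne_zero hJ]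
    intro y hy
    obtain ⟨c, hc⟩ := hbJ y hy
    refine (FractionalIdeal.mem_coeIdeal _).mpr ⟨c * r, Ideal.mul_mem_left _ c hr, ?_⟩
    rw [map_mul, hc, map_mul, Algebra.smul_def]
    ring
  rw [h0, FractionalIdeal.mem_zero_iff, FaithfulSMul.algebraMap_eq_zero_iff] at hmem
  exact mul_ne_zero hr0 (nonZeroDivisors.ne_zero hb) hmem

/-- The colon `ω : J` is the orthogonal complement of `J`, so `ω : (ω : J) = J` is the double
complement theorem; it applies because `J` contains all series of high order. -/
theorem isCanonicalIdeal_canonicalIdeal (hF : ∀ x, F < x → x ∈ H) :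
    IsCanonicalIdeal (FractionRing (semigroupRing k H)) (canonicalIdeal k H F) := by
  have := isFractionRing_laurentSeries (k := k) hF
  refine ⟨canonicalIdeal_ne_bot hF, fun J hJ => ?_⟩
  have hquot := canonicalIdeal_div_ne_zero (k := k) hF hJ
  ext x
  refine ⟨fun hx => ?_, fun hx => ?_⟩
  · rw [mem_canonicalIdeal_div_iff hF hquot] at hx
    obtain ⟨N, hN⟩ := exists_forall_mem_laurentSubmodule hF hJ
    rw [← algEquiv_mem_laurentSubmodule]
    refine LaurentSeries.mem_of_forall_orthogonal (2 * F + 1) N _ hN fun g hg => ?_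
    have h1 := hx ((FractionRing.algEquiv (semigroupRing k H) (LaurentSeries k)).symm g)
      ((mem_canonicalIdeal_div_iff hF hJ).mpr fun y hy => by
        rw [AlgEquiv.apply_symm_apply]
        exact hg _ (algEquiv_mem_laurentSubmodule.mpr hy))
    rwa [AlgEquiv.apply_symm_apply, mul_comm] at h1
  · rw [FractionalIdeal.mem_div_iff_of_ne_zero hquot]
    intro y hy
    rw [mul_comm]
    exact (FractionalIdeal.mem_div_iff_of_ne_zero hJ).mp hy x hx

/-! ### The blowup algebra when `G` is a gap, and the conclusion. -/

/-- If the predecessor of the Frobenius number is a gap, then the blowup algebra of the canonical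
ideal is `k[[t]]`. -/
theorem blowupAlgebra_canonicalIdeal_eq_range [IsFractionRing (semigroupRing k H) (LaurentSeries k)]
    {G : ℕ} (hF : ∀ x, G + 1 < x → x ∈ H) (hG1 : G + 1 ∉ H) (hG : G ∉ H) :
    blowupAlgebra (FractionRing (semigroupRing k H)) (canonicalIdeal k H (G + 1)) =
      (powerSeriesEmbedding k H).range := by
  obtain ⟨u, hu, hu'⟩ := exists_X_pow_mem_canonicalIdeal (k := k) (i := 0) hF (by omega) hG1
  obtain ⟨t, ht, ht'⟩ := exists_X_pow_mem_canonicalIdeal (k := k) (i := 1) hF (by omega) hG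
  rw [add_zero] at hu'
  have hu0 : u ≠ 0 := by
    rintro rfl
    exact pow_ne_zero _ X_ne_zero hu'.symm
  have hdvd : ∀ f ∈ canonicalIdeal k H (G + 1), ∃ x ∈ (powerSeriesEmbedding k H).range,
      algebraMap _ (FractionRing (semigroupRing k H)) f = algebraMap _ _ u * x := fun f hf => by
    obtain ⟨g, hg⟩ := X_pow_dvd_of_mem_canonicalIdeal hF hf
    refine ⟨_, ⟨g, rfl⟩, ?_⟩
    change _ = _ * powerSeriesEmbedding k H g
    rw [← powerSeriesEmbedding_coe, ← powerSeriesEmbedding_coe, hg, map_mul, hu']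
  refine le_antisymm (blowupAlgebra_le_of_forall_mul hu ?_ _ hdvd) ?_
  · rwa [Ne, FaithfulSMul.algebraMap_eq_zero_iff]
  set W := IsLocalization.coeSubmodule (FractionRing (semigroupRing k H))
    (canonicalIdeal k H (G + 1))
  have memW : ∀ {r : semigroupRing k H}, r ∈ canonicalIdeal k H (G + 1) →
      powerSeriesEmbedding k H r ∈ W := fun {r} hr => by
    rw [powerSeriesEmbedding_coe]
    exact (IsLocalization.mem_coeSubmodule _ _).mpr ⟨r, hr, rfl⟩
  -- With `t = u * X`, the products `u ^ (G + 2 - i) * t ^ i` give the monomials of degree `i < G +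
  -- 2`; multiples of `X ^ (G + 2)` come from `u ^ (G + 1)` times one element of the ideal. Together
  -- with `hdvd` this identifies `W ^ (G + 2)` with `u ^ (G + 2) k[[X]]`, which is stable under
  -- `k[[X]]`.
  have hpow : ∀ f : k⟦X⟧, powerSeriesEmbedding k H ((u : k⟦X⟧) ^ (G + 2) * f) ∈ W ^ (G + 2) := by
    refine induction_C_mul_X_pow (G + 2) (fun f g hf hg => ?_) (fun c i hi => ?_) (fun f => ?_)
    · rw [mul_add, map_add]
      exact add_mem hf hg
    · have h1 : (u : k⟦X⟧) ^ (G + 2) * (C c * X ^ i) =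
          ((⟨C c, C_mem c⟩ : semigroupRing k H) : k⟦X⟧) *
            ((u : k⟦X⟧) ^ (G + 2 - i) * (t : k⟦X⟧) ^ i) := by
        obtain ⟨d, hd⟩ := Nat.exists_eq_add_of_lt hi
        rw [hd, show i + d + 1 - i = d + 1 by omega, hu', ht']
        ring
      rw [h1, map_mul, map_mul, map_pow, map_pow, powerSeriesEmbedding_coe ⟨C c, _⟩,
        ← Algebra.smul_def, ← Nat.sub_add_cancel hi.le, pow_add W, Nat.add_sub_cancel]
      exact Submodule.smul_mem _ _ (Submodule.mul_mem_mul (Submodule.pow_mem_pow _ (memW hu) _)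
        (Submodule.pow_mem_pow _ (memW ht) _))
    · obtain ⟨r, hr, h⟩ := exists_X_pow_mul_mem_canonicalIdeal (k := k) hF f
      have h1 : (u : k⟦X⟧) ^ (G + 2) * (X ^ (G + 2) * f) =
          (u : k⟦X⟧) ^ (G + 1) * (r : k⟦X⟧) := by
        rw [h, hu']; ring
      rw [h1, map_mul, map_pow, pow_succ W]
      exact Submodule.mul_mem_mul (Submodule.pow_mem_pow _ (memW hu) _) (memW hr)
  rintro _ ⟨f, rfl⟩
  refine ⟨G + 2, ?_⟩
  rw [Submodule.mem_div_iff_forall_mul_mem]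
  intro y hy
  obtain ⟨_, ⟨g, rfl⟩, rfl⟩ := mem_coeSubmodule_pow_of_forall_mul _ hdvd _ hy
  convert hpow (f * g) using 1
  change powerSeriesEmbedding k H f * (_ * powerSeriesEmbedding k H g) = _
  rw [map_mul, map_pow, map_mul, powerSeriesEmbedding_coe]
  ring

/-- The ring `k[[H]]` has minimal canonical conductor if and only if the predecessor of the
Frobenius number of `H` is a gap. -/
theorem hasMinimalCanonicalConductor_iff {G : ℕ} (hG1 : G + 1 ∉ H) (hF : ∀ x, G + 1 < x → x ∈ H) :
    HasMinimalCanonicalConductor (semigroupRing k H) ↔ G ∉ H := by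
  refine ⟨notMem_of_hasMinimalCanonicalConductor hG1 hF, fun hG => ?_⟩
  have := isFractionRing_laurentSeries (k := k) hF
  refine ⟨canonicalIdeal k H (G + 1), isCanonicalIdeal_canonicalIdeal hF, ?_⟩
  rw [blowupConductor, normalizationConductor, blowupAlgebra_canonicalIdeal_eq_range hF hG1 hG,
    integralClosure_eq_range hF]

end semigroupRing

theorem mainTheorem3 (k : Type*) [Field k] (H : AddSubmonoid ℕ) (hH : IsNumericalSemigroup H)
    (n : ℕ) (hn : 2 ≤ n) (a : Fin n → ℕ) (ha : StrictMono a) (ha₁ : a ⟨0, by omega⟩ = n)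
    (hgen : IsMinimallyGeneratedBy H (Set.range a))
    (hne : H ≠ AddSubmonoid.closure {2, 3}) :
    HasMinimalCanonicalConductor (semigroupRing k H) ↔
      a ⟨n - 1, by omega⟩ = a ⟨n - 2, by omega⟩ + 1 := by
  obtain ⟨G, hG1, hF, h⟩ := exists_frobenius_of_card_generators_eq hn ha ha₁ hgen hne
  exact (semigroupRing.hasMinimalCanonicalConductor_iff hG1 hF).trans h
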